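/- Let $n\ge 1$ be fixed and let $0\le\rho_0<1$. Let $\Phi$ be the standard normal distribution function. Let $F$ be the cumulative distribution function of a probability distribution on $\mathbb R$, put $\bar F=1-F$ and $Q_F(t)=\inf\{x\in\mathbb R: t\le F(x)\}$, and assume that $F$ is regularly varying with tail index $\gamma\ge 0$, i.e. $\lim_{x\to+\infty}\bar F(xy)/\bar F(x)=y^{-\gamma}$ for every $y>0$. Let $\mathcal N_{\rho_0}$ be the set of all joint laws of test statistics $(T_1,\dots,T_n)$ (the laws allowed under the global null hypothesis) such that every $T_i$ is standard normal and, for all $i\ne j$, the pair $(T_i,T_j)$ is bivariate normal with correlation $\rho_{ij}\in[-\rho_0,\rho_0]$; nothing else is assumed about the joint law. Given p-values $P_i$, set $X_i=Q_F(1-P_i)$. At level $\alpha$ consider 1. the sum-based test, which rejects when $\sum_{i=1}^n X_i>Q_F(1-\alpha/n)$; 2. if $\gamma=1$, the average-based test, which rejects when $\frac1n\sum_{i=1}^n X_i>Q_F(1-\alpha)$; 3. for fixed weights $\omega_1,\dots,\omega_n\ge 0$, not all zero (and all positive if $\gamma=0$), the weighted test, which rejects when $\sum_{i=1}^n\omega_iX_i>Q_F(1-\alpha/\kappa)$,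 where $\kappa=\sum_{i=1}^n\omega_i^\gamma$. If the p-values are two-sided, $P_i=2-2\Phi(|T_i|)$, then each of these tests satisfies $$\lim_{\alpha\to0^+}\ \sup_{P\in\mathcal N_{\rho_0}}\frac{P(\text{the test rejects at level }\alpha)}{\alpha}=1 ,$$ and moreover $P(\text{the test rejects at level }\alpha)/\alpha\to1$ as $\alpha\to0^+$ uniformly over $P\in\mathcal N_{\rho_0}$. The same holds for the one-sided p-values $P_i=1-\Phi(T_i)$ if in addition $\bar F(x)\ge F(-x)$ for all sufficiently large $x$. -/

import Mathlib

open MeasureTheory ProbabilityTheory Filter Topology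

namespace HeavyTail

noncomputable section

/-- Standard normal cumulative distribution function `Φ`. -/
def stdNormalCDF (x : ℝ) : ℝ := cdf (gaussianReal 0 1) x

/-- Survival function `1 - F` of the distribution `ν`, where `F = cdf ν`. -/
def survival (ν : Measure ℝ) (x : ℝ) : ℝ := 1 - cdf ν x

/-- Quantile function `Q_F(t) = inf {x | t ≤ F x}` of the distribution `ν`, where `F = cdf ν`.
For `0 < t < 1` the set is nonempty and bounded below, so this is a genuine infimum. -/
def quantile (ν : Measure ℝ) (t : ℝ) : ℝ := sInf {x : ℝ | t ≤ cdf ν x}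

/-- `ν` is regularly varying (at `+∞`) with tail index `γ ≥ 0`. As the limits are nonzero, the
survival function is automatically positive everywhere, so no quotient is by zero. -/
def RegularlyVarying (ν : Measure ℝ) (γ : ℝ) : Prop :=
  0 ≤ γ ∧ ∀ y : ℝ, 0 < y →
    Tendsto (fun x : ℝ => survival ν (x * y) / survival ν x) atTop (𝓝 (y ^ (-γ)))

/-- Pearson correlation of two real random variables. -/
def correlation {Ω : Type*} [MeasurableSpace Ω] (X Y : Ω → ℝ) (P : Measure Ω) : ℝ :=
  covariance X Y P / (√(variance X P) * √(variance Y P))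

/-- `P` is a possible joint law of the test statistics `(T₁, …, Tₙ)` under the global null:
standard normal marginals, bivariate normal pairs, and all pairwise correlations in `[-ρ₀, ρ₀]`.
Nothing else is assumed about the joint law. The statistic `Tᵢ` is the `i`-th coordinate. -/
structure IsNullLaw {n : ℕ} (ρ₀ : ℝ) (P : Measure (Fin n → ℝ)) : Prop where
  isProbabilityMeasure : IsProbabilityMeasure P
  marginal : ∀ i, P.map (fun T => T i) = gaussianReal 0 1
  pair : ∀ i j, i ≠ j → IsGaussian (P.map (fun T => (T i, T j)))
  corr : ∀ i j, i ≠ j → correlation (fun T => T i) (fun T => T j) P ∈ Set.Icc (-ρ₀) ρ₀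

/-- Two-sided p-value of a test statistic with value `t`. -/
def twoSidedPValue (t : ℝ) : ℝ := 2 - 2 * stdNormalCDF |t|

/-- One-sided p-value of a test statistic with value `t`. -/
def oneSidedPValue (t : ℝ) : ℝ := 1 - stdNormalCDF t

/-- Transformed statistic `X = Q_F(1 - P)`, where `P = p t` is the p-value of the statistic `t`.
(For two-sided p-values the argument `1 - P` is `0` only at `t = 0`, a null event.) -/
def transformed (ν : Measure ℝ) (p : ℝ → ℝ) (t : ℝ) : ℝ := quantile ν (1 - p t)

/-- Event that the sum-based combination test rejects at level `α`. -/
def sumTest (n : ℕ) (ν : Measure ℝ) (p : ℝ → ℝ) (α : ℝ) : Set (Fin n → ℝ) :=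
  {T | quantile ν (1 - α / n) < ∑ i, transformed ν p (T i)}

/-- Event that the average-based combination test rejects at level `α`. -/
def averageTest (n : ℕ) (ν : Measure ℝ) (p : ℝ → ℝ) (α : ℝ) : Set (Fin n → ℝ) :=
  {T | quantile ν (1 - α) < (∑ i, transformed ν p (T i)) / n}

/-- Event that the weighted combination test with weights `ω` rejects at level `α`; here `γ` is the
tail index of `ν`. -/
def weightedTest {n : ℕ} (ν : Measure ℝ) (γ : ℝ) (ω : Fin n → ℝ) (p : ℝ → ℝ) (α : ℝ) :
    Set (Fin n → ℝ) :=
  {T | quantile ν (1 - α / ∑ i, ω i ^ γ) < ∑ i, ω i * transformed ν p (T i)}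

/-- Type-I error, under the null law `P`, of the test with rejection events `R α`, divided by the
level `α`. -/
def errorRatio {n : ℕ} (R : ℝ → Set (Fin n → ℝ)) (α : ℝ) (P : Measure (Fin n → ℝ)) : ℝ :=
  P.real (R α) / α

/-- As `α → 0⁺`, the supremum of (type-I error)/`α` over all null laws with correlations in
`[-ρ₀, ρ₀]` tends to `1`, and (type-I error)/`α` tends to `1` uniformly over these null laws. -/
def AsymptoticallyExact {n : ℕ} (ρ₀ : ℝ) (R : ℝ → Set (Fin n → ℝ)) : Prop :=
  Tendsto (fun α : ℝ => ⨆ P : {P : Measure (Fin n → ℝ) // IsNullLaw ρ₀ P}, errorRatio R α P.1)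
    (𝓝[>] 0) (𝓝 1) ∧
  TendstoUniformlyOn (errorRatio R) (fun _ => 1) (𝓝[>] 0) {P | IsNullLaw ρ₀ P}

end

end HeavyTail

namespace HeavyTail

/-! ### The standard normal distribution function -/

/-! The principle is that of a single big jump: under regular variation a weighted sum of the `X i`
exceeds a high level `x` essentially only when one term does so alone. Each term contributes
`survival ν (x / ω i)`, which is asymptotic to `ω i ^ γ * survival ν x`, so the total is `κ *
survival ν x`. At `x = quantile ν (1 - α / κ)` this is asymptotic to `α`, even if `F` has jumps
(`RegularlyVarying.tendsto_survival_quantile`).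

Two effects could spoil this, and both concern only pairs of statistics. Two terms may be moderately
large at once; this is negligible because the average of two signed standard normals with
correlation bounded away from `±1` has variance below one, hence a lighter tail
(`exists_real_pair_tail_le`). Or a large term may be cancelled by a very negative one. For one-sided
p-values the left-tail condition on `F` reduces this to the same estimate with opposite signs; for
two-sided ones a very negative `X j` forces `T j` near `0`, which has small conditional probability
(`IsNullLaw.real_and_abs_lt_le`).

All bounds depend on the null law only through `ρ₀`, which gives uniformity. `IsTailPValue` isolates
what is needed of the p-values, and the sum and average tests are special weighted tests. -/

lemma stdNormalCDF_eq_real (x : ℝ) :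
    stdNormalCDF x = (gaussianReal 0 1).real (Set.Iic x) :=
  cdf_eq_real _ x

lemma stdNormalCDF_strictMono : StrictMono stdNormalCDF := by
  intro x y hxy
  rw [stdNormalCDF_eq_real, stdNormalCDF_eq_real, ← Set.Iic_union_Ioc_eq_Iic hxy.le,
    measureReal_union (Set.Iic_disjoint_Ioc le_rfl) measurableSet_Ioc]
  have h : (gaussianReal 0 1) (Set.Ioc x y) ≠ 0 := fun h0 => by
    have := gaussianReal_absolutelyContinuous' 0 one_ne_zero h0
    rw [Real.volume_Ioc, ENNReal.ofReal_eq_zero] at this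
    linarith
  have : 0 < (gaussianReal 0 1).real (Set.Ioc x y) :=
    ENNReal.toReal_pos h (measure_ne_top _ _)
  linarith

lemma stdNormalCDF_continuous : Continuous stdNormalCDF := by
  rw [continuous_iff_continuousAt]
  intro x
  have := nullSingletonClass_gaussianReal (μ := 0) (v := 1) one_ne_zero
  have h1 : (cdf (gaussianReal 0 1)).measure {x} = 0 := by
    rw [measure_cdf]; exact measure_singleton x
  rw [StieltjesFunction.measure_singleton, ENNReal.ofReal_eq_zero] at h1
  have hm := monotone_cdf (gaussianReal 0 1)
  have h2 : ContinuousAt (cdf (gaussianReal 0 1)) x := by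
    rw [hm.continuousAt_iff_leftLim_eq_rightLim, StieltjesFunction.rightLim_eq]
    exact le_antisymm (hm.leftLim_le le_rfl) (by linarith)
  exact h2

lemma stdNormalCDF_neg (x : ℝ) : stdNormalCDF (-x) = 1 - stdNormalCDF x := by
  have := nullSingletonClass_gaussianReal (μ := 0) (v := 1) one_ne_zero
  rw [stdNormalCDF_eq_real, stdNormalCDF_eq_real, ← probReal_compl_eq_one_sub measurableSet_Iic,
    Set.compl_Iic, measureReal_congr (Ioi_ae_eq_Ici (μ := gaussianReal 0 1) (a := x))]
  have h := gaussianReal_map_neg (μ := 0) (v := 1)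
  rw [neg_zero] at h
  conv_lhs => rw [← h]
  rw [map_measureReal_apply measurable_neg measurableSet_Iic]
  congr 1
  ext y
  simp

lemma stdNormalCDF_neg_eq_real (x : ℝ) :
    stdNormalCDF (-x) = (gaussianReal 0 1).real (Set.Ici x) := by
  have := nullSingletonClass_gaussianReal (μ := 0) (v := 1) one_ne_zero
  rw [stdNormalCDF_neg, stdNormalCDF_eq_real, ← probReal_compl_eq_one_sub measurableSet_Iic,
    Set.compl_Iic, measureReal_congr (Ioi_ae_eq_Ici (μ := gaussianReal 0 1) (a := x))]

lemma stdNormalCDF_pos (x : ℝ) : 0 < stdNormalCDF x :=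
  (cdf_nonneg _ (x - 1)).trans_lt (stdNormalCDF_strictMono (by linarith))

lemma stdNormalCDF_lt_one (x : ℝ) : stdNormalCDF x < 1 :=
  (stdNormalCDF_strictMono (lt_add_one x)).trans_le (cdf_le_one _ _)

lemma stdNormalCDF_zero : stdNormalCDF 0 = 1 / 2 := by
  have := stdNormalCDF_neg 0
  rw [neg_zero] at this
  linarith

lemma exists_stdNormalCDF_neg_eq {w : ℝ} (h0 : 0 < w) (h1 : w < 1) :
    ∃ z, stdNormalCDF (-z) = w := by
  obtain ⟨a, ha⟩ := ((tendsto_cdf_atBot (gaussianReal 0 1)).eventually (gt_mem_nhds h0)).exists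
  obtain ⟨b, hb⟩ := ((tendsto_cdf_atTop (gaussianReal 0 1)).eventually (lt_mem_nhds h1)).exists
  obtain ⟨z, hz⟩ := mem_range_of_exists_le_of_exists_ge stdNormalCDF_continuous
    ⟨a, ha.le⟩ ⟨b, hb.le⟩
  exact ⟨-z, by rwa [neg_neg]⟩

/-- A centred normal law of variance less than one has a much lighter tail than the standard normal
law. -/
lemma gaussianReal_Ici_le {a b z : ℝ} {v : NNReal} (ha : 0 < a) (hav : a ≤ v) (hvb : v ≤ b)
    (hz : 0 ≤ z) (hb : b ≤ 1) :
    (gaussianReal 0 v).real (Set.Ici z) ≤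
      (√a)⁻¹ * Real.exp (-((1 / b - 1) / 2 * z ^ 2)) * stdNormalCDF (-z) := by
  have hv0 : (0 : ℝ) < v := ha.trans_le hav
  have hv : v ≠ 0 := by rintro rfl; simp at hv0
  have hb0 : 0 < b := hv0.trans_le hvb
  rw [stdNormalCDF_neg_eq_real, measureReal_def, measureReal_def,
    gaussianReal_apply_eq_integral _ hv, gaussianReal_apply_eq_integral _ one_ne_zero,
    ENNReal.toReal_ofReal (integral_nonneg fun x => gaussianPDFReal_nonneg _ _ x),
    ENNReal.toReal_ofReal (integral_nonneg fun x => gaussianPDFReal_nonneg _ _ x),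
    ← integral_const_mul]
  -- The densities are compared pointwise: their quotient at `x` is `v ^ (-1/2) * exp (-(1 / v - 1)
  -- * x ^ 2 / 2)`, and `a ≤ v ≤ b ≤ 1`, `0 ≤ z ≤ x` bound both factors.
  refine setIntegral_mono_on (integrable_gaussianPDFReal _ _).integrableOn
    ((integrable_gaussianPDFReal _ _).const_mul _).integrableOn measurableSet_Ici fun x hx => ?_
  have hx : z ≤ x := hx
  rw [gaussianPDFReal, gaussianPDFReal]
  have e1 : (√(2 * Real.pi * v))⁻¹ ≤ (√a)⁻¹ * (√(2 * Real.pi * (1 : NNReal)))⁻¹ := by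
    rw [← mul_inv, ← Real.sqrt_mul ha.le]
    have h : a * (2 * Real.pi * (1 : NNReal)) ≤ 2 * Real.pi * v := by
      push_cast
      nlinarith [Real.pi_pos]
    gcongr
  have e2 : Real.exp (-(x - 0) ^ 2 / (2 * v)) ≤
      Real.exp (-((1 / b - 1) / 2 * z ^ 2)) * Real.exp (-(x - 0) ^ 2 / (2 * (1 : NNReal))) := by
    rw [← Real.exp_add]
    gcongr
    have h1 : 1 / b ≤ 1 / (v : ℝ) := by gcongr
    have h2 : 1 ≤ 1 / b := by rw [le_div_iff₀ hb0]; linarith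
    have h3 : z ^ 2 ≤ x ^ 2 := by gcongr
    have h4 : (1 / b - 1) * z ^ 2 ≤ (1 / (v : ℝ) - 1) * x ^ 2 := by
      gcongr
      linarith
    have h5 : -(x - 0) ^ 2 / (2 * (v : ℝ)) = - (1 / (v : ℝ) * x ^ 2 / 2) := by
      field_simp; ring
    rw [h5]
    push_cast
    linarith
  calc _ ≤ ((√a)⁻¹ * (√(2 * Real.pi * (1 : NNReal)))⁻¹) *
        (Real.exp (-((1 / b - 1) / 2 * z ^ 2)) *
          Real.exp (-(x - 0) ^ 2 / (2 * (1 : NNReal)))) := by gcongr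
    _ = _ := by ring

/-- The density is at most `(√a)⁻¹` everywhere, and the interval has length `2 * s`. -/
lemma gaussianReal_Ioo_le {a r s : ℝ} {v : NNReal} (ha : 0 < a) (hav : a ≤ v) :
    gaussianReal 0 v (Set.Ioo (r - s) (r + s)) ≤ ENNReal.ofReal (2 * (√a)⁻¹ * s) := by
  have hv0 : (0 : ℝ) < v := ha.trans_le hav
  have hv : v ≠ 0 := by rintro rfl; simp at hv0
  rw [gaussianReal_apply _ hv]
  calc _ ≤ ∫⁻ x in Set.Ioo (r - s) (r + s), ENNReal.ofReal (√a)⁻¹ := by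
        refine lintegral_mono fun x => ENNReal.ofReal_le_ofReal ?_
        rw [gaussianPDFReal]
        have e1 : (√(2 * Real.pi * v))⁻¹ ≤ (√a)⁻¹ := by
          gcongr
          nlinarith [Real.pi_gt_three]
        have e2 : Real.exp (-(x - 0) ^ 2 / (2 * v)) ≤ 1 := by
          rw [Real.exp_le_one_iff]
          exact div_nonpos_of_nonpos_of_nonneg (by nlinarith [sq_nonneg (x - 0)]) (by positivity)
        calc _ ≤ (√a)⁻¹ * 1 := by gcongr
          _ = _ := mul_one _
    _ = _ := by
        rw [setLIntegral_const, Real.volume_Ioo, ← ENNReal.ofReal_mul (by positivity)]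
        congr 1; ring

/-! ### Null laws -/

section NullLaw

variable {n : ℕ} {ρ₀ : ℝ} {P : Measure (Fin n → ℝ)}

lemma IsNullLaw.hasLaw (hP : IsNullLaw ρ₀ P) (i : Fin n) :
    HasLaw (fun T => T i) (gaussianReal 0 1) P :=
  ⟨(measurable_pi_apply i).aemeasurable, hP.marginal i⟩

lemma IsNullLaw.real_preimage (hP : IsNullLaw ρ₀ P) (i : Fin n) {s : Set ℝ}
    (hs : MeasurableSet s) : P.real {T | T i ∈ s} = (gaussianReal 0 1).real s := by
  rw [← hP.marginal i, map_measureReal_apply (measurable_pi_apply i) hs]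
  rfl

lemma IsNullLaw.integral_eq_zero (hP : IsNullLaw ρ₀ P) (i : Fin n) : ∫ T, T i ∂P = 0 := by
  rw [(hP.hasLaw i).integral_eq, integral_id_gaussianReal]

lemma IsNullLaw.variance_eq_one (hP : IsNullLaw ρ₀ P) (i : Fin n) :
    variance (fun T => T i) P = 1 := by
  rw [(hP.hasLaw i).variance_eq, variance_id_gaussianReal, NNReal.coe_one]

lemma IsNullLaw.memLp_two (hP : IsNullLaw ρ₀ P) (i : Fin n) : MemLp (fun T => T i) 2 P :=
  (hP.hasLaw i).hasGaussianLaw.memLp_two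

lemma IsNullLaw.covariance_mem (hP : IsNullLaw ρ₀ P) {i j : Fin n} (hij : i ≠ j) :
    covariance (fun T : Fin n → ℝ => T i) (fun T => T j) P ∈ Set.Icc (-ρ₀) ρ₀ := by
  have := hP.corr i j hij
  rwa [correlation, hP.variance_eq_one, hP.variance_eq_one, Real.sqrt_one, mul_one,
    div_one] at this

lemma IsNullLaw.hasGaussianLaw_pair (hP : IsNullLaw ρ₀ P) {i j : Fin n} (hij : i ≠ j) :
    HasGaussianLaw (fun T => (T i, T j)) P :=
  ⟨hP.pair i j hij⟩

lemma IsNullLaw.map_linear (hP : IsNullLaw ρ₀ P) {i j : Fin n} (hij : i ≠ j) (a b : ℝ) :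
    P.map (fun T => a * T i + b * T j) = gaussianReal 0
      (a ^ 2 + b ^ 2 +
        2 * (a * b * covariance (fun T : Fin n → ℝ => T i) (fun T => T j) P)).toNNReal := by
  have := hP.isProbabilityMeasure
  have hg : HasGaussianLaw (fun T => a * T i + b * T j) P :=
    (hP.hasGaussianLaw_pair hij).map_fun
      (a • ContinuousLinearMap.fst ℝ ℝ ℝ + b • ContinuousLinearMap.snd ℝ ℝ ℝ)
  have hi := hP.memLp_two i
  have hj := hP.memLp_two j
  rw [hg.map_eq_gaussianReal, variance_fun_add (hi.const_mul a) (hj.const_mul b),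
    variance_const_mul, variance_const_mul, hP.variance_eq_one, hP.variance_eq_one,
    covariance_const_mul_left, covariance_const_mul_right,
    integral_add ((hi.integrable (by norm_num)).const_mul a)
      ((hj.integrable (by norm_num)).const_mul b), integral_const_mul, integral_const_mul,
    hP.integral_eq_zero, hP.integral_eq_zero]
  congr 2 <;> ring

/-- Two coordinates are asymptotically tail independent, uniformly over the null laws. -/
lemma exists_real_pair_tail_le (n : ℕ) (hρ₀ : 0 ≤ ρ₀) (hρ₁ : ρ₀ < 1) {ε : ℝ} (hε : 0 < ε) :
    ∃ w₀ > 0, ∀ w, 0 < w → w < w₀ → ∀ P : Measure (Fin n → ℝ), IsNullLaw ρ₀ P →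
      ∀ i j, i ≠ j → ∀ s t : ℝ, (s = 1 ∨ s = -1) → (t = 1 ∨ t = -1) →
        P.real {T | stdNormalCDF (-(s * T i)) ≤ w ∧ stdNormalCDF (-(t * T j)) ≤ w} ≤ ε * w := by
  -- For signs `s`, `t` the average `(s * T i + t * T j) / 2` has variance `(1 + s * t * r) / 2`,
  -- which lies in `[a, b]` with `b < 1`. If both signed coordinates are at least `z`, so is the
  -- average.
  set a := (1 - ρ₀) / 2 with ha_def
  set b := (1 + ρ₀) / 2 with hb_def
  have ha : 0 < a := by linarith
  have hb : 0 < b := by linarith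
  have hb1 : b < 1 := by linarith
  have hc : 0 < (1 / b - 1) / 2 := by
    have : 1 < 1 / b := by rw [lt_div_iff₀ hb]; linarith
    linarith
  have hlim : Tendsto (fun z : ℝ => (√a)⁻¹ * Real.exp (-((1 / b - 1) / 2 * z ^ 2))) atTop
      (𝓝 ((√a)⁻¹ * 0)) := by
    refine Tendsto.const_mul _ (Real.tendsto_exp_neg_atTop_nhds_zero.comp ?_)
    exact (tendsto_pow_atTop two_ne_zero).const_mul_atTop hc
  rw [mul_zero] at hlim
  obtain ⟨z₀, hz₀⟩ := eventually_atTop.1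
    ((hlim.eventually (ge_mem_nhds hε)).and (eventually_ge_atTop 0))
  refine ⟨stdNormalCDF (-z₀), stdNormalCDF_pos _, fun w hw0 hw1 P hP i j hij s t hs ht => ?_⟩
  have := hP.isProbabilityMeasure
  obtain ⟨z, rfl⟩ := exists_stdNormalCDF_neg_eq hw0 (hw1.trans (stdNormalCDF_lt_one _))
  have hz : z₀ ≤ z := by
    have := stdNormalCDF_strictMono.lt_iff_lt.1 hw1
    linarith
  obtain ⟨hzε, hz0⟩ := hz₀ z hz
  have hcov := hP.covariance_mem hij
  set r := covariance (fun T : Fin n → ℝ => T i) (fun T => T j) P with hr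
  have hmap := hP.map_linear hij (s / 2) (t / 2)
  rw [← hr] at hmap
  set v := ((s / 2) ^ 2 + (t / 2) ^ 2 + 2 * (s / 2 * (t / 2) * r)) with hv
  have hv' : a ≤ v ∧ v ≤ b := by
    rcases hs with rfl | rfl <;> rcases ht with rfl | rfl <;> constructor <;>
      linarith [hcov.1, hcov.2]
  have hvn : (v.toNNReal : ℝ) = v := Real.coe_toNNReal _ (ha.le.trans hv'.1)
  calc _ ≤ P.real ((fun T => s / 2 * T i + t / 2 * T j) ⁻¹' Set.Ici z) := by
        refine measureReal_mono fun T hT => ?_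
        have h1 := stdNormalCDF_strictMono.le_iff_le.1 hT.1
        have h2 := stdNormalCDF_strictMono.le_iff_le.1 hT.2
        change z ≤ s / 2 * T i + t / 2 * T j
        linarith
    _ = (gaussianReal 0 v.toNNReal).real (Set.Ici z) := by
        rw [← hmap, map_measureReal_apply (by fun_prop) measurableSet_Ici]
    _ ≤ _ := gaussianReal_Ici_le ha (by rw [hvn]; exact hv'.1) (by rw [hvn]; exact hv'.2)
        hz0 hb1.le
    _ ≤ _ := by
        have := stdNormalCDF_pos (-z)
        gcongr

/-- One coordinate has a conditionally bounded density given another one. -/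
lemma IsNullLaw.real_and_abs_lt_le (hP : IsNullLaw ρ₀ P) (hρ₀ : 0 ≤ ρ₀) (hρ₁ : ρ₀ < 1)
    {i j : Fin n} (hij : i ≠ j) {s : Set ℝ} (hs : MeasurableSet s) {η : ℝ} (hη : 0 ≤ η) :
    P.real {T | T i ∈ s ∧ |T j| < η} ≤
      2 * (√(1 - ρ₀ ^ 2))⁻¹ * η * P.real {T | T i ∈ s} := by
  have := hP.isProbabilityMeasure
  have hcov := hP.covariance_mem hij
  set r := covariance (fun T : Fin n → ℝ => T i) (fun T => T j) P with hr
  have hi := hP.memLp_two i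
  have hj := hP.memLp_two j
  -- The residual `T j - r * T i` is uncorrelated with `T i`, hence independent of it by joint
  -- normality, and has variance `1 - r ^ 2 ≥ 1 - ρ₀ ^ 2`. Given `T i = x`, the event `|T j| < η`
  -- puts it in an interval of length `2 * η` about `-(r * x)`.
  have hg : HasGaussianLaw (fun T => (T i, -r * T i + 1 * T j)) P :=
    (hP.hasGaussianLaw_pair hij).map_fun ((ContinuousLinearMap.fst ℝ ℝ ℝ).prod
      ((-r) • ContinuousLinearMap.fst ℝ ℝ ℝ + (1 : ℝ) • ContinuousLinearMap.snd ℝ ℝ ℝ))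
  have hind : IndepFun (fun T : Fin n → ℝ => T i) (fun T => -r * T i + 1 * T j) P := by
    refine hg.indepFun_of_covariance_eq_zero ?_
    have hadd := covariance_add_right hi (hi.const_mul (-r)) (hj.const_mul 1)
    rw [Pi.add_def] at hadd
    rw [hadd, covariance_const_mul_right, covariance_const_mul_right, covariance_self hi.aemeasurable,
      hP.variance_eq_one, ← hr]
    ring
  have hprod := (indepFun_iff_map_prod_eq_prod_map_map hg.fst.aemeasurable hg.snd.aemeasurable).1 hind
  rw [hP.marginal i, hP.map_linear hij (-r) 1, ← hr] at hprod
  set v := ((-r) ^ 2 + 1 ^ 2 + 2 * (-r * 1 * r)) with hv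
  have hr2 : r ^ 2 ≤ ρ₀ ^ 2 := sq_le_sq' hcov.1 hcov.2
  have ha : 0 < 1 - ρ₀ ^ 2 := by nlinarith
  have hv' : 1 - ρ₀ ^ 2 ≤ v.toNNReal := by
    refine le_trans ?_ (Real.le_coe_toNNReal _)
    rw [hv]; linarith
  set B : Set (ℝ × ℝ) := {q | q.1 ∈ s ∧ |q.2 + r * q.1| < η} with hB
  have hBm : MeasurableSet B := by
    have h : MeasurableSet {q : ℝ × ℝ | |q.2 + r * q.1| < η} :=
      measurableSet_lt (by fun_prop) measurable_const
    exact (measurable_fst hs).inter h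
  have key : P {T | T i ∈ s ∧ |T j| < η} ≤
      ENNReal.ofReal (2 * (√(1 - ρ₀ ^ 2))⁻¹ * η) * P {T | T i ∈ s} := by
    calc P {T | T i ∈ s ∧ |T j| < η}
        = P.map (fun T => (T i, -r * T i + 1 * T j)) B := by
          rw [Measure.map_apply (by fun_prop) hBm]
          congr 1
          ext T
          simp only [hB, Set.mem_ofPred_eq, Set.mem_preimage]
          ring_nf
      _ = ∫⁻ x, (gaussianReal 0 v.toNNReal) (Prod.mk x ⁻¹' B) ∂(gaussianReal 0 1) := by
          rw [hprod, Measure.prod_apply hBm]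
      _ ≤ ∫⁻ x, s.indicator (fun _ => ENNReal.ofReal (2 * (√(1 - ρ₀ ^ 2))⁻¹ * η)) x
            ∂(gaussianReal 0 1) := by
          refine lintegral_mono fun x => ?_
          by_cases hx : x ∈ s
          · rw [Set.indicator_of_mem hx]
            refine (measure_mono ?_).trans (gaussianReal_Ioo_le (r := -(r * x)) ha hv')
            intro y hy
            have := abs_lt.1 hy.2
            constructor <;> linarith [this.1, this.2]
          · have : Prod.mk x ⁻¹' B = ∅ := by
              ext y; simp [hB, hx]
            simp [this]
      _ = _ := by
          rw [lintegral_indicator_const hs, ← hP.marginal i,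
            Measure.map_apply (measurable_pi_apply i) hs]
          rfl
  have := ENNReal.toReal_mono (ENNReal.mul_ne_top ENNReal.ofReal_ne_top (measure_ne_top _ _)) key
  rwa [ENNReal.toReal_mul, ENNReal.toReal_ofReal (by positivity)] at this

/-- Independent test statistics form a null law. -/
lemma isNullLaw_pi (n : ℕ) (hρ₀ : 0 ≤ ρ₀) :
    IsNullLaw ρ₀ (Measure.pi fun _ : Fin n => gaussianReal 0 1) := by
  have hmarg (i : Fin n) : (Measure.pi fun _ : Fin n => gaussianReal 0 1).map (fun T => T i) =
      gaussianReal 0 1 := (measurePreserving_eval (fun _ : Fin n => gaussianReal 0 1) i).map_eq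
  have hlaw (i : Fin n) : HasGaussianLaw (fun T : Fin n → ℝ => T i)
      (Measure.pi fun _ : Fin n => gaussianReal 0 1) := ⟨by rw [hmarg i]; infer_instance⟩
  have hind : iIndepFun (fun (i : Fin n) (T : Fin n → ℝ) => T i)
      (Measure.pi fun _ : Fin n => gaussianReal 0 1) :=
    iIndepFun_pi (X := fun _ x => x) (fun _ => aemeasurable_id')
  refine ⟨inferInstance, hmarg, fun i j hij => ?_, fun i j hij => ?_⟩
  · exact ((hind.hasGaussianLaw hlaw).prodMk i j).isGaussian_map
  · rw [correlation, (hind.indepFun hij).covariance_eq_zero (hlaw i).memLp_two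
      (hlaw j).memLp_two, zero_div]
    exact ⟨by linarith, hρ₀⟩

end NullLaw

/-! ### p-values -/

lemma survival_antitone (ν : Measure ℝ) : Antitone (survival ν) := fun _ _ h =>
  sub_le_sub_left (monotone_cdf ν h) 1

lemma tendsto_survival_atTop (ν : Measure ℝ) : Tendsto (survival ν) atTop (𝓝 0) := by
  have := (tendsto_cdf_atTop ν).const_sub 1
  rwa [sub_self] at this

lemma oneSidedPValue_eq (t : ℝ) : oneSidedPValue t = stdNormalCDF (-t) :=
  (stdNormalCDF_neg t).symm

lemma twoSidedPValue_eq (t : ℝ) : twoSidedPValue t = 2 * stdNormalCDF (-|t|) := by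
  rw [twoSidedPValue, stdNormalCDF_neg]; ring

/-- The properties of a p-value function that make the combination tests asymptotically exact:
uniformity, pairwise tail independence of the p-values, and negligibility of a small p-value
together with one that is close to one. -/
structure IsTailPValue (n : ℕ) (ρ₀ : ℝ) (ν : Measure ℝ) (p : ℝ → ℝ) : Prop where
  measurable : Measurable p
  pos : ∀ t, 0 < p t
  lt_one : ∀ t, t ≠ 0 → p t < 1
  uniform : ∀ u, 0 < u → u < 1 → ∀ P : Measure (Fin n → ℝ), IsNullLaw ρ₀ P → ∀ i,
    P.real {T | p (T i) < u} = u
  pair : ∀ ε > 0, ∃ u₀ > 0, ∀ u, 0 < u → u < u₀ → ∀ P : Measure (Fin n → ℝ), IsNullLaw ρ₀ P →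
    ∀ i j, i ≠ j → P.real {T | p (T i) < u ∧ p (T j) < u} ≤ ε * u
  opposite : ∀ ε > 0, ∀ᶠ x in atTop, ∀ P : Measure (Fin n → ℝ), IsNullLaw ρ₀ P →
    ∀ i j, i ≠ j →
      P.real {T | p (T i) < survival ν x ∧ 1 - cdf ν (-x) ≤ p (T j)} ≤ ε * survival ν x

lemma isTailPValue_oneSided {n : ℕ} {ρ₀ : ℝ} (hρ₀ : 0 ≤ ρ₀) (hρ₁ : ρ₀ < 1) {ν : Measure ℝ}
    (hpos : ∀ x, 0 < survival ν x) (hν : ∀ᶠ x : ℝ in atTop, cdf ν (-x) ≤ survival ν x) :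
    IsTailPValue n ρ₀ ν oneSidedPValue where
  measurable := by
    unfold oneSidedPValue
    exact (stdNormalCDF_continuous.measurable).const_sub 1
  pos t := by rw [oneSidedPValue_eq]; exact stdNormalCDF_pos _
  lt_one t _ := by rw [oneSidedPValue_eq]; exact stdNormalCDF_lt_one _
  uniform u hu0 hu1 P hP i := by
    obtain ⟨z, rfl⟩ := exists_stdNormalCDF_neg_eq hu0 hu1
    have := nullSingletonClass_gaussianReal (μ := 0) (v := 1) one_ne_zero
    have h : {T : Fin n → ℝ | oneSidedPValue (T i) < stdNormalCDF (-z)} =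
        {T | T i ∈ Set.Ioi z} := by
      ext T
      simp [oneSidedPValue_eq, stdNormalCDF_strictMono.lt_iff_lt]
    rw [h, hP.real_preimage i measurableSet_Ioi, measureReal_congr Ioi_ae_eq_Ici,
      stdNormalCDF_neg_eq_real]
  pair ε hε := by
    obtain ⟨w₀, hw₀, h⟩ := exists_real_pair_tail_le n hρ₀ hρ₁ hε
    refine ⟨w₀, hw₀, fun u hu0 hu1 P hP i j hij => ?_⟩
    have := hP.isProbabilityMeasure
    refine le_trans (measureReal_mono fun T hT => ?_)
      (h u hu0 hu1 P hP i j hij 1 1 (.inl rfl) (.inl rfl))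
    rw [Set.mem_ofPred_eq, oneSidedPValue_eq, oneSidedPValue_eq] at hT
    rw [Set.mem_ofPred_eq, one_mul, one_mul]
    exact ⟨hT.1.le, hT.2.le⟩
  opposite ε hε := by
    obtain ⟨w₀, hw₀, h⟩ := exists_real_pair_tail_le n hρ₀ hρ₁ hε
    filter_upwards [hν, (tendsto_survival_atTop ν).eventually (gt_mem_nhds hw₀)]
      with x hx hx0 P hP i j hij
    have := hP.isProbabilityMeasure
    refine le_trans (measureReal_mono fun T hT => ?_)
      -- The condition on `T j` reads `Φ (T j) ≤ F (-x)`; the left-tail hypothesis bounds this by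
      -- `survival ν x`, so `-T j` is extreme at the same level as `T i`.
      (h _ (hpos x) hx0 P hP i j hij 1 (-1) (.inl rfl) (.inr rfl))
    rw [Set.mem_ofPred_eq, oneSidedPValue_eq, oneSidedPValue_eq, stdNormalCDF_neg (T j)] at hT
    rw [Set.mem_ofPred_eq, one_mul, neg_mul, one_mul, neg_neg]
    exact ⟨hT.1.le, by linarith [hT.2]⟩

lemma twoSidedPValue_lt_iff {u t : ℝ} :
    twoSidedPValue t < u ↔ stdNormalCDF (-t) < u / 2 ∨ stdNormalCDF t < u / 2 := by
  rw [twoSidedPValue_eq]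
  have hm := stdNormalCDF_strictMono.monotone
  rcases le_total 0 t with ht | ht
  · rw [abs_of_nonneg ht]
    have := hm (show -t ≤ t by linarith)
    constructor
    · intro h; left; linarith
    · rintro (h | h) <;> linarith
  · rw [abs_of_nonpos ht, neg_neg]
    have := hm (show t ≤ -t by linarith)
    constructor
    · intro h; right; linarith
    · rintro (h | h) <;> linarith

lemma isTailPValue_twoSided {n : ℕ} {ρ₀ : ℝ} (hρ₀ : 0 ≤ ρ₀) (hρ₁ : ρ₀ < 1) {ν : Measure ℝ}
    (hpos : ∀ x, 0 < survival ν x) : IsTailPValue n ρ₀ ν twoSidedPValue := by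
  have hmeas : Measurable twoSidedPValue := by
    unfold twoSidedPValue
    exact ((stdNormalCDF_continuous.comp continuous_abs).measurable.const_mul 2).const_sub 2
  have huniform : ∀ u, 0 < u → u < 1 → ∀ P : Measure (Fin n → ℝ), IsNullLaw ρ₀ P → ∀ i,
      P.real {T | twoSidedPValue (T i) < u} = u := by
    intro u hu0 hu1 P hP i
    obtain ⟨z, hz⟩ := exists_stdNormalCDF_neg_eq (half_pos hu0) (by linarith)
    have := nullSingletonClass_gaussianReal (μ := 0) (v := 1) one_ne_zero
    have hz0 : 0 < z := by
      have : stdNormalCDF (-z) < stdNormalCDF 0 := by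
        rw [hz, stdNormalCDF_zero]; linarith
      linarith [stdNormalCDF_strictMono.lt_iff_lt.1 this]
    have h : {T : Fin n → ℝ | twoSidedPValue (T i) < u} =
        {T | T i ∈ Set.Ioi z ∪ Set.Iio (-z)} := by
      ext T
      rw [Set.mem_ofPred_eq, Set.mem_ofPred_eq, twoSidedPValue_lt_iff, ← hz,
        stdNormalCDF_strictMono.lt_iff_lt, stdNormalCDF_strictMono.lt_iff_lt, neg_lt_neg_iff]
      rfl
    rw [h, hP.real_preimage i (measurableSet_Ioi.union measurableSet_Iio),
      measureReal_union _ measurableSet_Iio, measureReal_congr Ioi_ae_eq_Ici,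
      measureReal_congr Iio_ae_eq_Iic, ← stdNormalCDF_neg_eq_real, ← stdNormalCDF_eq_real, hz,
      add_halves]
    rw [Set.disjoint_left]
    intro y hy1 hy2
    have h1 : z < y := hy1
    have h2 : y < -z := hy2
    linarith
  refine ⟨hmeas, fun t => ?_, fun t ht => ?_, huniform, fun ε hε => ?_, fun ε hε => ?_⟩
  · rw [twoSidedPValue_eq]
    exact mul_pos two_pos (stdNormalCDF_pos _)
  · rw [twoSidedPValue_eq]
    have : stdNormalCDF (-|t|) < stdNormalCDF 0 :=
      stdNormalCDF_strictMono (by simpa using ht)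
    rw [stdNormalCDF_zero] at this
    linarith
  · obtain ⟨w₀, hw₀, h⟩ := exists_real_pair_tail_le n hρ₀ hρ₁ (half_pos hε)
    refine ⟨w₀, hw₀, fun u hu0 hu1 P hP i j hij => ?_⟩
    have := hP.isProbabilityMeasure
    -- Each small two-sided p-value comes from one of two tails; the four sign choices cost `ε / 2 *
    -- (u / 2)` each, in total `ε * u`.
    set E : ℝ → ℝ → Set (Fin n → ℝ) := fun s t =>
      {T | stdNormalCDF (-(s * T i)) ≤ u / 2 ∧ stdNormalCDF (-(t * T j)) ≤ u / 2} with hE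
    have hE' : ∀ s t : ℝ, (s = 1 ∨ s = -1) → (t = 1 ∨ t = -1) → P.real (E s t) ≤ ε / 2 * (u / 2) :=
      h (u / 2) (half_pos hu0) (by linarith) P hP i j hij
    calc _ ≤ P.real ((E 1 1 ∪ E 1 (-1)) ∪ (E (-1) 1 ∪ E (-1) (-1))) := by
          refine measureReal_mono fun T hT => ?_
          rw [Set.mem_ofPred_eq, twoSidedPValue_lt_iff, twoSidedPValue_lt_iff] at hT
          simp only [hE, Set.mem_union, Set.mem_ofPred_eq, one_mul, neg_mul, neg_neg]
          rcases hT with ⟨h1 | h1, h2 | h2⟩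
          · exact .inl (.inl ⟨h1.le, h2.le⟩)
          · exact .inl (.inr ⟨h1.le, h2.le⟩)
          · exact .inr (.inl ⟨h1.le, h2.le⟩)
          · exact .inr (.inr ⟨h1.le, h2.le⟩)
      _ ≤ (P.real (E 1 1) + P.real (E 1 (-1))) + (P.real (E (-1) 1) + P.real (E (-1) (-1))) :=
          (measureReal_union_le _ _).trans
            (add_le_add (measureReal_union_le _ _) (measureReal_union_le _ _))
      _ ≤ (ε / 2 * (u / 2) + ε / 2 * (u / 2)) + (ε / 2 * (u / 2) + ε / 2 * (u / 2)) := by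
          gcongr <;> apply hE' <;> simp
      _ = _ := by ring
  · set K := 2 * (√(1 - ρ₀ ^ 2))⁻¹ with hK
    have hK0 : 0 < K := by
      have : 0 < 1 - ρ₀ ^ 2 := by nlinarith
      positivity
    -- A p-value near `1` forces `|T j| < η`, and `K * η = ε` matches the conditional density bound.
    -- As `F (-x)` tends to `0`, no comparison of the two tails of `F` is needed.
    set η := ε / K with hη
    have hη0 : 0 < η := div_pos hε hK0
    have hv0 : 0 < 1 - 2 * stdNormalCDF (-η) := by
      have : stdNormalCDF (-η) < stdNormalCDF 0 := stdNormalCDF_strictMono (by linarith)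
      rw [stdNormalCDF_zero] at this
      linarith
    filter_upwards [(tendsto_survival_atTop ν).eventually (gt_mem_nhds one_pos),
      ((tendsto_cdf_atBot ν).comp tendsto_neg_atTop_atBot).eventually (gt_mem_nhds hv0)]
      with x hx hx' P hP i j hij
    have := hP.isProbabilityMeasure
    have hs : MeasurableSet {t | twoSidedPValue t < survival ν x} :=
      measurableSet_lt hmeas measurable_const
    calc _ ≤ P.real {T | T i ∈ {t | twoSidedPValue t < survival ν x} ∧ |T j| < η} := by
          refine measureReal_mono fun T hT => ⟨hT.1, ?_⟩
          have h2 := hT.2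
          rw [twoSidedPValue_eq] at h2
          have hx2 : cdf ν (-x) < 1 - 2 * stdNormalCDF (-η) := hx'
          have : stdNormalCDF (-η) < stdNormalCDF (-|T j|) := by linarith
          linarith [stdNormalCDF_strictMono.lt_iff_lt.1 this]
      _ ≤ K * η * P.real {T | T i ∈ {t | twoSidedPValue t < survival ν x}} :=
          hP.real_and_abs_lt_le hρ₀ hρ₁ hij hs hη0.le
      _ = ε * survival ν x := by
          rw [hη, mul_div_cancel₀ _ hK0.ne']
          congr 1
          exact huniform _ (hpos x) hx P hP i

/-! ### Quantiles and regular variation -/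

lemma lt_quantile_iff {ν : Measure ℝ} {t y : ℝ} (h0 : 0 < t) (h1 : t < 1) :
    y < quantile ν t ↔ cdf ν y < t := by
  have hbdd : BddBelow {x : ℝ | t ≤ cdf ν x} := by
    obtain ⟨b, hb⟩ := ((tendsto_cdf_atBot ν).eventually (gt_mem_nhds h0)).exists
    refine ⟨b, fun x hx => ?_⟩
    by_contra! hlt
    have h : t ≤ cdf ν x := hx
    linarith [monotone_cdf ν hlt.le]
  have hne : {x : ℝ | t ≤ cdf ν x}.Nonempty := by
    obtain ⟨b, hb⟩ := ((tendsto_cdf_atTop ν).eventually (lt_mem_nhds h1)).exists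
    exact ⟨b, hb.le⟩
  constructor
  · intro h
    by_contra! hle
    exact absurd (csInf_le hbdd hle) (not_le.2 h)
  · intro h
    -- Right continuity yields a point `z > y` still below level `t`, which makes the inequality for
    -- the infimum strict.
    have hev : ∀ᶠ z in 𝓝[>] y, cdf ν z < t :=
      (((cdf ν).right_continuous y).mono Set.Ioi_subset_Ici_self).eventually (gt_mem_nhds h)
    obtain ⟨z, hz, hyz⟩ := (hev.and self_mem_nhdsWithin).exists
    have hyz : y < z := hyz
    refine hyz.trans_le (le_csInf hne fun x hx => ?_)
    by_contra! hlt
    have h : t ≤ cdf ν x := hx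
    linarith [monotone_cdf ν hlt.le]

lemma lt_transformed_iff {ν : Measure ℝ} {p : ℝ → ℝ} {t y : ℝ} (h0 : 0 < p t) (h1 : p t < 1) :
    y < transformed ν p t ↔ p t < survival ν y := by
  rw [transformed, lt_quantile_iff (by linarith) (by linarith), survival, lt_sub_comm]

section RegularVariation

variable {ν : Measure ℝ} {γ : ℝ}

lemma RegularlyVarying.survival_pos (hν : RegularlyVarying ν γ) (x : ℝ) : 0 < survival ν x := by
  have h := hν.2 1 one_pos
  rw [Real.one_rpow] at h
  obtain ⟨z, hz, hxz⟩ := ((h.eventually (lt_mem_nhds one_half_lt_one)).and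
    (eventually_ge_atTop x)).exists
  have hz0 : 0 ≤ survival ν z := sub_nonneg.2 (cdf_le_one ν z)
  -- Division by zero gives `0`, which is incompatible with a quotient near the limit `1`.
  have hz1 : survival ν z ≠ 0 := fun h0 => by
    rw [h0, div_zero] at hz
    linarith
  exact (lt_of_le_of_ne hz0 hz1.symm).trans_le (survival_antitone ν hxz)

lemma RegularlyVarying.tendsto_mul_left (hν : RegularlyVarying ν γ) {c : ℝ} (hc : 0 < c) :
    Tendsto (fun x => survival ν (c * x) / survival ν x) atTop (𝓝 (c ^ (-γ))) := by
  simpa only [mul_comm c] using hν.2 c hc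

lemma tendsto_quantile_atTop (hpos : ∀ x, 0 < survival ν x) :
    Tendsto (fun a => quantile ν (1 - a)) (𝓝[>] 0) atTop := by
  refine tendsto_atTop.2 fun b => ?_
  filter_upwards [Ioo_mem_nhdsGT (lt_min one_pos (hpos b))] with a ha
  have h1 := ha.2.trans_le (min_le_left _ _)
  have h2 := ha.2.trans_le (min_le_right _ _)
  rw [survival] at h2
  exact ((lt_quantile_iff (by linarith) (by linarith [ha.1])).2 (by linarith)).le

/-- Always `survival ν q ≤ a` at `q = quantile ν (1 - a)`, possibly strictly if `F` jumps at `q`.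
For `c < 1` and `q > 0`, the point `c * q` lies below the quantile, so `a < survival ν (c * q)`,
which is asymptotic to `c ^ (-γ) * survival ν q`; then `c` is taken close to `1`. -/
lemma RegularlyVarying.tendsto_survival_quantile (hν : RegularlyVarying ν γ) :
    Tendsto (fun a => survival ν (quantile ν (1 - a)) / a) (𝓝[>] 0) (𝓝 1) := by
  have hQ := tendsto_quantile_atTop hν.survival_pos
  refine tendsto_order.2 ⟨fun l hl => ?_, fun l hl => ?_⟩
  · have hcont : Tendsto (fun c : ℝ => (c ^ (-γ))⁻¹) (𝓝[<] 1) (𝓝 1) := by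
      have : ContinuousAt (fun c : ℝ => (c ^ (-γ))⁻¹) 1 :=
        (Real.continuousAt_rpow_const _ _ (.inl one_ne_zero)).inv₀ (by simp)
      have h := this.tendsto
      simp only [Real.one_rpow, inv_one] at h
      exact h.mono_left nhdsWithin_le_nhds
    obtain ⟨c, hcl, hc0, hc1⟩ := ((hcont.eventually (lt_mem_nhds hl)).and
      (Ioo_mem_nhdsLT one_pos)).exists
    have hlim := ((hν.tendsto_mul_left hc0).inv₀ (Real.rpow_pos_of_pos hc0 _).ne').comp hQ
    filter_upwards [hlim.eventually (lt_mem_nhds hcl), hQ.eventually (eventually_gt_atTop 0),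
      Ioo_mem_nhdsGT one_pos] with a ha hqa ha1
    refine lt_of_lt_of_le ha ?_
    have h := (lt_quantile_iff (ν := ν) (t := 1 - a) (y := c * quantile ν (1 - a))
      (by linarith [ha1.2]) (by linarith [ha1.1])).1 (by nlinarith)
    have ha0 : 0 < a := ha1.1
    simp only [Function.comp_apply, inv_div]
    have := hν.survival_pos (quantile ν (1 - a))
    gcongr
    rw [survival]
    linarith
  · filter_upwards [Ioo_mem_nhdsGT one_pos] with a ha
    refine lt_of_le_of_lt ?_ hl
    have h := (lt_quantile_iff (ν := ν) (t := 1 - a) (y := quantile ν (1 - a))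
      (by linarith [ha.2]) (by linarith [ha.1])).not.1 (lt_irrefl _)
    rw [div_le_one ha.1, survival]
    linarith

end RegularVariation

/-! ### Deterministic comparison of a weighted sum with its largest term -/

section Deterministic

variable {n : ℕ} {ω X : Fin n → ℝ} {x ε δ : ℝ}

/-- If at most one `X i` exceeded `δ * x`, its term would be at most `(1 - ε) * x` and the others
would add at most `ε * x`. -/
lemma exists_pair_of_lt_sum (hω : ∀ i, 0 ≤ ω i) (hx : 0 < x) (hδ : 0 ≤ δ) (hε : ε < 1)
    (hδε : δ * ∑ i, ω i ≤ ε) (hsum : x < ∑ i, ω i * X i)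
    (hmax : ∀ i, ω i * X i ≤ (1 - ε) * x) :
    ∃ i j, i ≠ j ∧ δ * x < X i ∧ δ * x < X j := by
  by_contra! hcon
  have hε0 : 0 ≤ ε := (mul_nonneg hδ (Finset.sum_nonneg fun i _ => hω i)).trans hδε
  have hall : ∃ s : Finset (Fin n), s.card ≤ 1 ∧ ∀ j ∉ s, X j ≤ δ * x := by
    by_cases h : ∃ i, δ * x < X i
    · obtain ⟨i, hi⟩ := h
      exact ⟨{i}, by simp, fun j hj => hcon i j (by simpa [eq_comm] using hj) hi⟩
    · push Not at h
      exact ⟨∅, by simp, fun j _ => h j⟩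
  obtain ⟨s, hs, hsX⟩ := hall
  have h1 : ∑ i ∈ s, ω i * X i ≤ (1 - ε) * x := by
    calc _ ≤ s.card • ((1 - ε) * x) := Finset.sum_le_card_nsmul _ _ _ fun i _ => hmax i
      _ ≤ 1 • ((1 - ε) * x) := by
          have : 0 ≤ (1 - ε) * x := mul_nonneg (by linarith) hx.le
          gcongr
      _ = _ := one_nsmul _
  have h2 : ∑ i ∈ sᶜ, ω i * X i ≤ ε * x := by
    calc _ ≤ ∑ i ∈ sᶜ, ω i * (δ * x) := by
          refine Finset.sum_le_sum fun i hi => ?_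
          have := hω i
          have := hsX i (Finset.mem_compl.1 hi)
          gcongr
      _ ≤ ∑ i, ω i * (δ * x) :=
          Finset.sum_le_sum_of_subset_of_nonneg (Finset.subset_univ _)
            fun i _ _ => mul_nonneg (hω i) (mul_nonneg hδ hx.le)
      _ = (δ * ∑ i, ω i) * x := by rw [← Finset.sum_mul]; ring
      _ ≤ ε * x := by gcongr
  have := Finset.sum_add_sum_compl s fun i => ω i * X i
  linarith

/-- The remaining terms can pull the sum down by at most `ε * x`. -/
lemma lt_sum_of_lt (hω : ∀ i, 0 ≤ ω i) (hx : 0 < x) (hδ : 0 ≤ δ)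
    (hδε : δ * ∑ i, ω i ≤ ε) {i : Fin n} (hi : (1 + ε) * x < ω i * X i)
    (hlow : ∀ j, j ≠ i → -(δ * x) ≤ X j) : x < ∑ i, ω i * X i := by
  have h1 : -(ε * x) ≤ ∑ j ∈ {i}ᶜ, ω j * X j := by
    calc -(ε * x) ≤ -((δ * ∑ i, ω i) * x) := by gcongr
      _ = ∑ j, ω j * (-(δ * x)) := by rw [← Finset.sum_mul]; ring
      _ ≤ ∑ j ∈ {i}ᶜ, ω j * (-(δ * x)) := by
          rw [← Finset.sum_add_sum_compl {i} fun j => ω j * (-(δ * x)), Finset.sum_singleton]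
          have := mul_nonneg (hω i) (mul_nonneg hδ hx.le)
          linarith
      _ ≤ _ := by
          refine Finset.sum_le_sum fun j hj => ?_
          have := hω j
          have := hlow j (by simpa using hj)
          gcongr
  have := Finset.sum_add_sum_compl {i} fun i => ω i * X i
  rw [Finset.sum_singleton] at this
  linarith

end Deterministic

/-! ### The tail of a weighted sum of transformed statistics -/

section WeightedSum

variable {n : ℕ} {ρ₀ γ : ℝ} {ν : Measure ℝ} {p : ℝ → ℝ} {ω : Fin n → ℝ}

/-- Tail probability at `y` of `w` times a random variable with law `ν`, for `w ≥ 0` and `y > 0`. -/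
noncomputable def scaledSurvival (ν : Measure ℝ) (w y : ℝ) : ℝ :=
  if w = 0 then 0 else survival ν (y / w)

lemma RegularlyVarying.tendsto_scaledSurvival (hν : RegularlyVarying ν γ) {w c : ℝ} (hw : 0 ≤ w)
    (hwγ : γ = 0 → 0 < w) (hc : 0 < c) :
    Tendsto (fun x => scaledSurvival ν w (c * x) / survival ν x) atTop
      (𝓝 (c ^ (-γ) * w ^ γ)) := by
  rcases hw.eq_or_lt with rfl | hw
  · have hγ : γ ≠ 0 := fun h => lt_irrefl _ (hwγ h)
    simp [scaledSurvival, Real.zero_rpow hγ]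
  · have h := hν.tendsto_mul_left (div_pos hc hw)
    rw [Real.div_rpow hc.le hw.le, Real.rpow_neg hw.le, div_inv_eq_mul] at h
    refine h.congr fun x => ?_
    rw [scaledSurvival, if_neg hw.ne', mul_div_right_comm]

lemma RegularlyVarying.tendsto_sum_scaledSurvival (hν : RegularlyVarying ν γ)
    (hω : ∀ i, 0 ≤ ω i) (hωγ : γ = 0 → ∀ i, 0 < ω i) {c : ℝ} (hc : 0 < c) :
    Tendsto (fun x => (∑ i, scaledSurvival ν (ω i) (c * x)) / survival ν x) atTop
      (𝓝 (c ^ (-γ) * ∑ i, ω i ^ γ)) := by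
  simp_rw [Finset.sum_div, Finset.mul_sum]
  exact tendsto_finsetSum _ fun i _ =>
    hν.tendsto_scaledSurvival (hω i) (fun h => hωγ h i) hc

/-- The event that `w` times the transformed `i`-th statistic exceeds `y`, for `w ≥ 0` and `y > 0`,
in terms of the p-value. -/
def exceedance (ν : Measure ℝ) (p : ℝ → ℝ) (w y : ℝ) (i : Fin n) : Set (Fin n → ℝ) :=
  {T | w ≠ 0 ∧ p (T i) < survival ν (y / w)}

/-- The event that the transformed `i`-th and `j`-th statistics both exceed `y`. -/
def jointExceedance (ν : Measure ℝ) (p : ℝ → ℝ) (y : ℝ) (i j : Fin n) : Set (Fin n → ℝ) :=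
  {T | i ≠ j ∧ p (T i) < survival ν y ∧ p (T j) < survival ν y}

/-- The event that the transformed `i`-th statistic exceeds `y` while the `j`-th is at most `-y`. -/
def oppositeExceedance (ν : Measure ℝ) (p : ℝ → ℝ) (y : ℝ) (i j : Fin n) : Set (Fin n → ℝ) :=
  {T | i ≠ j ∧ p (T i) < survival ν y ∧ 1 - cdf ν (-y) ≤ p (T j)}

lemma measurableSet_exceedance (hp : Measurable p) (w y : ℝ) (i : Fin n) :
    MeasurableSet (exceedance ν p w y i) :=
  (MeasurableSet.const _).inter
    (measurableSet_lt (hp.comp (measurable_pi_apply i)) measurable_const)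

lemma measurableSet_jointExceedance (hp : Measurable p) (y : ℝ) (i j : Fin n) :
    MeasurableSet (jointExceedance ν p y i j) :=
  (MeasurableSet.const _).inter
    ((measurableSet_lt (hp.comp (measurable_pi_apply i)) measurable_const).inter
      (measurableSet_lt (hp.comp (measurable_pi_apply j)) measurable_const))

lemma measurableSet_oppositeExceedance (hp : Measurable p) (y : ℝ) (i j : Fin n) :
    MeasurableSet (oppositeExceedance ν p y i j) :=
  (MeasurableSet.const _).inter
    ((measurableSet_lt (hp.comp (measurable_pi_apply i)) measurable_const).inter
      (measurableSet_le measurable_const (hp.comp (measurable_pi_apply j))))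

/-- At `t = 0` the two-sided p-value is `1` and the quantile at level `0` need not be a genuine
infimum; this null event is discarded. -/
lemma IsNullLaw.ae_ne_zero {P : Measure (Fin n → ℝ)} (hP : IsNullLaw ρ₀ P) :
    ∀ᵐ T ∂P, ∀ i, T i ≠ 0 := by
  have := hP.isProbabilityMeasure
  have := nullSingletonClass_gaussianReal (μ := 0) (v := 1) one_ne_zero
  refine ae_all_iff.2 fun i => ?_
  have h : P ((fun T : Fin n → ℝ => T i) ⁻¹' {0}) = 0 := by
    rw [← Measure.map_apply (measurable_pi_apply i) (measurableSet_singleton 0), hP.marginal i]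
    exact measure_singleton 0
  rw [ae_iff]
  convert h using 2
  ext T
  simp

lemma IsTailPValue.lt_transformed_iff (hp : IsTailPValue n ρ₀ ν p) {t y : ℝ} (ht : t ≠ 0) :
    y < transformed ν p t ↔ p t < survival ν y :=
  HeavyTail.lt_transformed_iff (hp.pos t) (hp.lt_one t ht)

lemma IsTailPValue.mem_exceedance_iff (hp : IsTailPValue n ρ₀ ν p) {w y : ℝ} (hw : 0 ≤ w)
    (hy : 0 < y) {i : Fin n} {T : Fin n → ℝ} (hT : T i ≠ 0) :
    T ∈ exceedance ν p w y i ↔ y < w * transformed ν p (T i) := by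
  rw [exceedance, Set.mem_ofPred_eq, ← hp.lt_transformed_iff hT]
  rcases hw.eq_or_lt with rfl | hw
  · simp [hy.le]
  · rw [div_lt_iff₀' hw]
    simp [hw.ne']

lemma IsTailPValue.eventually_real_exceedance (hp : IsTailPValue n ρ₀ ν p)
    (hpos : ∀ x, 0 < survival ν x) {w c : ℝ} (hw : 0 ≤ w) (hc : 0 < c) :
    ∀ᶠ x in atTop, ∀ P : Measure (Fin n → ℝ), IsNullLaw ρ₀ P → ∀ i,
      P.real (exceedance ν p w (c * x) i) = scaledSurvival ν w (c * x) := by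
  rcases hw.eq_or_lt with rfl | hw
  · simp [exceedance, scaledSurvival]
  · have h : Tendsto (fun x => survival ν (c * x / w)) atTop (𝓝 0) :=
      (tendsto_survival_atTop ν).comp ((tendsto_id.const_mul_atTop hc).atTop_div_const hw)
    filter_upwards [h.eventually (gt_mem_nhds one_pos)] with x hx P hP i
    simpa [exceedance, scaledSurvival, hw.ne'] using hp.uniform _ (hpos _) hx P hP i

/-- Converts error bounds at level `δ * x` into bounds relative to `survival ν x`. -/
lemma RegularlyVarying.exists_survival_mul_le (hν : RegularlyVarying ν γ) {δ : ℝ} (hδ : 0 < δ) :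
    ∃ C > 0, ∀ᶠ x in atTop, survival ν (δ * x) ≤ C * survival ν x := by
  refine ⟨δ ^ (-γ) + 1, by positivity, ?_⟩
  filter_upwards [(hν.tendsto_mul_left hδ).eventually (gt_mem_nhds (lt_add_one _))] with x hx
  exact ((div_lt_iff₀ (hν.survival_pos x)).1 hx).le

lemma IsTailPValue.eventually_real_jointExceedance_le (hp : IsTailPValue n ρ₀ ν p)
    (hν : RegularlyVarying ν γ) {δ θ : ℝ} (hδ : 0 < δ) (hθ : 0 < θ) :
    ∀ᶠ x in atTop, ∀ P : Measure (Fin n → ℝ), IsNullLaw ρ₀ P → ∀ i j,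
      P.real (jointExceedance ν p (δ * x) i j) ≤ θ * survival ν x := by
  obtain ⟨C, hC, hle⟩ := hν.exists_survival_mul_le hδ
  obtain ⟨u₀, hu₀, h⟩ := hp.pair (θ / C) (div_pos hθ hC)
  have hlim : Tendsto (fun x => survival ν (δ * x)) atTop (𝓝 0) :=
    (tendsto_survival_atTop ν).comp (tendsto_id.const_mul_atTop hδ)
  filter_upwards [hle, hlim.eventually (gt_mem_nhds hu₀)] with x hx hx0 P hP i j
  by_cases hij : i = j
  · have := (hν.survival_pos x).le
    simp only [jointExceedance, hij, ne_eq, not_true_eq_false, false_and, Set.ofPred_false,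
      measureReal_empty]
    positivity
  · simp only [jointExceedance, ne_eq, hij, not_false_eq_true, true_and]
    calc _ ≤ θ / C * survival ν (δ * x) := h _ (hν.survival_pos _) hx0 P hP i j hij
      _ ≤ θ / C * (C * survival ν x) := by gcongr
      _ = θ * survival ν x := by field_simp

lemma IsTailPValue.eventually_real_oppositeExceedance_le (hp : IsTailPValue n ρ₀ ν p)
    (hν : RegularlyVarying ν γ) {δ θ : ℝ} (hδ : 0 < δ) (hθ : 0 < θ) :
    ∀ᶠ x in atTop, ∀ P : Measure (Fin n → ℝ), IsNullLaw ρ₀ P → ∀ i j,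
      P.real (oppositeExceedance ν p (δ * x) i j) ≤ θ * survival ν x := by
  obtain ⟨C, hC, hle⟩ := hν.exists_survival_mul_le hδ
  have h := (tendsto_id.const_mul_atTop hδ).eventually (hp.opposite (θ / C) (div_pos hθ hC))
  filter_upwards [hle, h] with x hx h P hP i j
  by_cases hij : i = j
  · have := (hν.survival_pos x).le
    simp only [oppositeExceedance, hij, ne_eq, not_true_eq_false, false_and, Set.ofPred_false,
      measureReal_empty]
    positivity
  · simp only [oppositeExceedance, ne_eq, hij, not_false_eq_true, true_and]
    calc _ ≤ θ / C * survival ν (δ * x) := h P hP i j hij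
      _ ≤ θ / C * (C * survival ν x) := by gcongr
      _ = θ * survival ν x := by field_simp

/-- The event that the weighted sum of transformed statistics exceeds `x`. -/
def sumExceedance (ν : Measure ℝ) (p : ℝ → ℝ) (ω : Fin n → ℝ) (x : ℝ) : Set (Fin n → ℝ) :=
  {T | x < ∑ i, ω i * transformed ν p (T i)}

lemma IsTailPValue.real_sumExceedance_le (hp : IsTailPValue n ρ₀ ν p) (hω : ∀ i, 0 ≤ ω i)
    {P : Measure (Fin n → ℝ)} (hP : IsNullLaw ρ₀ P) {x ε δ : ℝ} (hx : 0 < x) (hδ : 0 ≤ δ)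
    (hε : ε < 1) (hδε : δ * ∑ i, ω i ≤ ε) :
    P.real (sumExceedance ν p ω x) ≤ ∑ i, P.real (exceedance ν p (ω i) ((1 - ε) * x) i) +
      ∑ i, ∑ j, P.real (jointExceedance ν p (δ * x) i j) := by
  have := hP.isProbabilityMeasure
  have hy : 0 < (1 - ε) * x := mul_pos (by linarith) hx
  have hsub : ∀ᵐ T ∂P, T ∈ sumExceedance ν p ω x → T ∈
      (⋃ i, exceedance ν p (ω i) ((1 - ε) * x) i) ∪
        ⋃ i, ⋃ j, jointExceedance ν p (δ * x) i j := by
    filter_upwards [hP.ae_ne_zero] with T hT0 hT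
    by_cases hmax : ∃ i, (1 - ε) * x < ω i * transformed ν p (T i)
    · obtain ⟨i, hi⟩ := hmax
      exact .inl (Set.mem_iUnion.2 ⟨i, (hp.mem_exceedance_iff (hω i) hy (hT0 i)).2 hi⟩)
    · push Not at hmax
      obtain ⟨i, j, hij, hi, hj⟩ := exists_pair_of_lt_sum hω hx hδ hε hδε hT hmax
      exact .inr (Set.mem_iUnion₂.2 ⟨i, j, hij, (hp.lt_transformed_iff (hT0 i)).1 hi,
        (hp.lt_transformed_iff (hT0 j)).1 hj⟩)
  calc _ ≤ P.real ((⋃ i, exceedance ν p (ω i) ((1 - ε) * x) i) ∪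
        ⋃ i, ⋃ j, jointExceedance ν p (δ * x) i j) :=
        ENNReal.toReal_mono (measure_ne_top _ _) (measure_mono_ae hsub)
    _ ≤ P.real (⋃ i, exceedance ν p (ω i) ((1 - ε) * x) i) +
        P.real (⋃ i, ⋃ j, jointExceedance ν p (δ * x) i j) := measureReal_union_le _ _
    _ ≤ _ := by
        gcongr
        · exact measureReal_iUnion_fintype_le _
        · exact (measureReal_iUnion_fintype_le _).trans
            (Finset.sum_le_sum fun i _ => measureReal_iUnion_fintype_le _)

/-- Once the bad events `E i` are removed, the single-term exceedances `B i` become disjoint, since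
two at once would be a joint exceedance. Each remaining piece forces the sum above `x`, so their
probabilities add up. -/
lemma IsTailPValue.le_real_sumExceedance (hp : IsTailPValue n ρ₀ ν p) (hω : ∀ i, 0 ≤ ω i)
    {P : Measure (Fin n → ℝ)} (hP : IsNullLaw ρ₀ P) {x ε δ : ℝ} (hx : 0 < x) (hδ : 0 ≤ δ)
    (hε : 0 ≤ ε) (hδε : δ * ∑ i, ω i ≤ ε) :
    ∑ i, P.real (exceedance ν p (ω i) ((1 + ε) * x) i) ≤ P.real (sumExceedance ν p ω x) +
      ∑ i, ∑ j, (P.real (jointExceedance ν p (δ * x) i j) +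
        P.real (oppositeExceedance ν p (δ * x) i j)) := by
  have := hP.isProbabilityMeasure
  have hy : 0 < (1 + ε) * x := mul_pos (by linarith) hx
  set B : Fin n → Set (Fin n → ℝ) := fun i => exceedance ν p (ω i) ((1 + ε) * x) i with hB
  set E : Fin n → Set (Fin n → ℝ) := fun i =>
    ⋃ j, (jointExceedance ν p (δ * x) i j ∪ oppositeExceedance ν p (δ * x) i j) with hE
  have hBm (i : Fin n) : MeasurableSet (B i) := measurableSet_exceedance hp.measurable _ _ _
  have hEm (i : Fin n) : MeasurableSet (E i) := MeasurableSet.iUnion fun j =>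
    (measurableSet_jointExceedance hp.measurable _ _ _).union
      (measurableSet_oppositeExceedance hp.measurable _ _ _)
  have hBlt {i : Fin n} {T : Fin n → ℝ} (h : T ∈ B i) : p (T i) < survival ν (δ * x) := by
    have hωi : 0 < ω i := lt_of_le_of_ne (hω i) h.1.symm
    refine h.2.trans_le (survival_antitone ν ?_)
    rw [le_div_iff₀ hωi]
    have h1 : ω i ≤ ∑ i, ω i := Finset.single_le_sum (fun j _ => hω j) (Finset.mem_univ i)
    have h2 : δ * ω i ≤ 1 + ε := by linarith [mul_le_mul_of_nonneg_left h1 hδ]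
    calc δ * x * ω i = δ * ω i * x := by ring
      _ ≤ (1 + ε) * x := by gcongr
  have hdisj : Pairwise (Function.onFun Disjoint fun i => B i \ E i) := by
    intro i j hij
    refine Set.disjoint_left.2 fun T hTi hTj => hTi.2 ?_
    exact Set.mem_iUnion.2 ⟨j, .inl ⟨hij, hBlt hTi.1, hBlt hTj.1⟩⟩
  have hsub : ∀ᵐ T ∂P, T ∈ (⋃ i, B i \ E i) → T ∈ sumExceedance ν p ω x := by
    filter_upwards [hP.ae_ne_zero] with T hT0 hT
    obtain ⟨i, hTB, hTE⟩ := Set.mem_iUnion.1 hT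
    refine lt_sum_of_lt hω hx hδ hδε ((hp.mem_exceedance_iff (hω i) hy (hT0 i)).1 hTB)
      fun j hj => le_of_lt ?_
    rw [hp.lt_transformed_iff (hT0 j)]
    by_contra! hlow
    exact hTE (Set.mem_iUnion.2 ⟨j, .inr ⟨hj.symm, hBlt hTB, hlow⟩⟩)
  have hle : ∑ i, P.real (B i \ E i) ≤ P.real (sumExceedance ν p ω x) := by
    rw [← measureReal_iUnion_fintype hdisj fun i => (hBm i).diff (hEm i)]
    exact ENNReal.toReal_mono (measure_ne_top _ _) (measure_mono_ae hsub)
  have hEle (i : Fin n) : P.real (E i) ≤ ∑ j, (P.real (jointExceedance ν p (δ * x) i j) +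
      P.real (oppositeExceedance ν p (δ * x) i j)) :=
    (measureReal_iUnion_fintype_le _).trans
      (Finset.sum_le_sum fun j _ => measureReal_union_le _ _)
  calc ∑ i, P.real (B i) ≤ ∑ i, (P.real (B i \ E i) + P.real (E i)) := by
        refine Finset.sum_le_sum fun i _ => ?_
        refine (measureReal_mono (s₂ := (B i \ E i) ∪ E i) ?_).trans (measureReal_union_le _ _)
        rw [Set.sdiff_union_self]
        exact Set.subset_union_left
    _ ≤ _ := by
        rw [Finset.sum_add_distrib]
        exact add_le_add hle (Finset.sum_le_sum fun i _ => hEle i)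

/-- Uniformly over the null laws, the tail of the weighted sum of transformed statistics is
asymptotic to `∑ ω i ^ γ` times the tail of `ν`. -/
lemma IsTailPValue.eventually_abs_real_sumExceedance_sub_le (hp : IsTailPValue n ρ₀ ν p)
    (hν : RegularlyVarying ν γ) (hω : ∀ i, 0 ≤ ω i) (hω0 : 0 < ∑ i, ω i)
    (hωγ : γ = 0 → ∀ i, 0 < ω i) {η : ℝ} (hη : 0 < η) :
    ∀ᶠ x in atTop, ∀ P : Measure (Fin n → ℝ), IsNullLaw ρ₀ P →
      |P.real (sumExceedance ν p ω x) - (∑ i, ω i ^ γ) * survival ν x| ≤ η * survival ν x := by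
  set κ := ∑ i, ω i ^ γ with hκ
  have hcont : Tendsto (fun c : ℝ => c ^ (-γ) * κ) (𝓝 1) (𝓝 κ) := by
    have h : ContinuousAt (fun c : ℝ => c ^ (-γ) * κ) 1 :=
      (Real.continuousAt_rpow_const _ _ (.inl one_ne_zero)).mul_const κ
    simpa using h.tendsto
  have hsub : Tendsto (fun e : ℝ => (1 - e) ^ (-γ) * κ) (𝓝[>] 0) (𝓝 κ) :=
    hcont.comp (((tendsto_const_nhds (x := (1 : ℝ))).sub tendsto_id).mono_left
      nhdsWithin_le_nhds |>.trans (by simp))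
  have hadd : Tendsto (fun e : ℝ => (1 + e) ^ (-γ) * κ) (𝓝[>] 0) (𝓝 κ) :=
    hcont.comp (((tendsto_const_nhds (x := (1 : ℝ))).add tendsto_id).mono_left
      nhdsWithin_le_nhds |>.trans (by simp))
  have hη2 : 0 < η / 2 := half_pos hη
  -- The error `η` is split in half: `ε` keeps `(1 ± ε) ^ (-γ) * κ` within `η / 2` of `κ`, and `θ`
  -- below makes the `n ^ 2` pair errors, each at most `2 * θ`, total at most `η / 2`.
  obtain ⟨ε, ⟨hε1, hε2⟩, hε0, hε⟩ :=
    (((hsub.eventually (gt_mem_nhds (show κ < κ + η / 2 by linarith))).and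
      (hadd.eventually (lt_mem_nhds (show κ - η / 2 < κ by linarith)))).and
        (Ioo_mem_nhdsGT one_pos)).exists
  set δ := ε / ∑ i, ω i with hδ_def
  have hδ : 0 < δ := div_pos hε0 hω0
  have hδε : δ * ∑ i, ω i ≤ ε := (div_mul_cancel₀ _ hω0.ne').le
  set θ := η / 2 / (2 * (n ^ 2 + 1)) with hθ_def
  have hθ : 0 < θ := by positivity
  have hθn : (n : ℝ) ^ 2 * (2 * θ) ≤ η / 2 := by
    rw [hθ_def]
    field_simp
    linarith
  have hB₁ : ∀ᶠ x in atTop, ∀ i, ∀ P : Measure (Fin n → ℝ), IsNullLaw ρ₀ P → ∀ k : Fin n,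
      P.real (exceedance ν p (ω i) ((1 - ε) * x) k) = scaledSurvival ν (ω i) ((1 - ε) * x) :=
    eventually_all.2 fun i =>
      hp.eventually_real_exceedance hν.survival_pos (hω i) (by linarith)
  have hB₂ : ∀ᶠ x in atTop, ∀ i, ∀ P : Measure (Fin n → ℝ), IsNullLaw ρ₀ P → ∀ k : Fin n,
      P.real (exceedance ν p (ω i) ((1 + ε) * x) k) = scaledSurvival ν (ω i) ((1 + ε) * x) :=
    eventually_all.2 fun i =>
      hp.eventually_real_exceedance hν.survival_pos (hω i) (by linarith)
  have hS₁ := (hν.tendsto_sum_scaledSurvival hω hωγ (show 0 < 1 - ε by linarith)).eventually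
    (gt_mem_nhds hε1)
  have hS₂ := (hν.tendsto_sum_scaledSurvival hω hωγ (show 0 < 1 + ε by linarith)).eventually
    (lt_mem_nhds hε2)
  filter_upwards [hB₁, hB₂, hS₁, hS₂, hp.eventually_real_jointExceedance_le hν hδ hθ,
    hp.eventually_real_oppositeExceedance_le hν hδ hθ, eventually_gt_atTop 0]
    with x hB₁ hB₂ hS₁ hS₂ hJ hO hx P hP
  have hS := hν.survival_pos x
  rw [div_lt_iff₀ hS] at hS₁
  rw [lt_div_iff₀ hS] at hS₂
  have hup := hp.real_sumExceedance_le hω hP hx hδ.le hε hδε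
  have hlow := hp.le_real_sumExceedance hω hP hx hδ.le hε0.le hδε
  simp only [hB₁ _ P hP] at hup
  simp only [hB₂ _ P hP] at hlow
  have hJs : ∑ i, ∑ j, P.real (jointExceedance ν p (δ * x) i j) ≤
      (n : ℝ) ^ 2 * (2 * θ) * survival ν x := by
    calc _ ≤ ∑ _i : Fin n, ∑ _j : Fin n, 2 * θ * survival ν x := by
          refine Finset.sum_le_sum fun i _ => Finset.sum_le_sum fun j _ => (hJ P hP i j).trans ?_
          gcongr
          linarith
      _ = _ := by simp; ring
  have hJO : ∑ i, ∑ j, (P.real (jointExceedance ν p (δ * x) i j) +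
      P.real (oppositeExceedance ν p (δ * x) i j)) ≤ (n : ℝ) ^ 2 * (2 * θ) * survival ν x := by
    calc _ ≤ ∑ _i : Fin n, ∑ _j : Fin n, 2 * θ * survival ν x := by
          refine Finset.sum_le_sum fun i _ => Finset.sum_le_sum fun j _ => ?_
          linarith [hJ P hP i j, hO P hP i j]
      _ = _ := by simp; ring
  have hθS : (n : ℝ) ^ 2 * (2 * θ) * survival ν x ≤ η / 2 * survival ν x := by gcongr
  rw [abs_le]
  constructor <;> nlinarith

end WeightedSum

/-! ### Asymptotic exactness -/

lemma asymptoticallyExact_of_eventually {n : ℕ} {ρ₀ : ℝ} (hρ₀ : 0 ≤ ρ₀)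
    {R : ℝ → Set (Fin n → ℝ)}
    (h : ∀ ε > 0, ∀ᶠ α in 𝓝[>] (0 : ℝ), ∀ P : Measure (Fin n → ℝ), IsNullLaw ρ₀ P →
      |errorRatio R α P - 1| ≤ ε) : AsymptoticallyExact ρ₀ R := by
  -- The supremum over an empty family would be `0`; the independent law rules this out and also
  -- supplies the lower bound.
  have : Nonempty {P : Measure (Fin n → ℝ) // IsNullLaw ρ₀ P} := ⟨⟨_, isNullLaw_pi n hρ₀⟩⟩
  constructor
  · refine Metric.tendsto_nhds.2 fun ε hε => ?_
    filter_upwards [h (ε / 2) (half_pos hε)] with α hα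
    have hle (P : {P : Measure (Fin n → ℝ) // IsNullLaw ρ₀ P}) :
        errorRatio R α P.1 ≤ 1 + ε / 2 := by linarith [(abs_le.1 (hα P.1 P.2)).2]
    have h1 := ciSup_le hle
    have h2 := le_ciSup (f := fun P : {P : Measure (Fin n → ℝ) // IsNullLaw ρ₀ P} =>
      errorRatio R α P.1) ⟨_, Set.forall_mem_range.2 hle⟩ ⟨_, isNullLaw_pi n hρ₀⟩
    have h3 := (abs_le.1 (hα _ (isNullLaw_pi n hρ₀))).1
    rw [Real.dist_eq, abs_lt]
    constructor <;> linarith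
  · refine Metric.tendstoUniformlyOn_iff.2 fun ε hε => ?_
    filter_upwards [h (ε / 2) (half_pos hε)] with α hα P hP
    rw [dist_comm, Real.dist_eq]
    linarith [hα P hP]

theorem IsTailPValue.asymptoticallyExact_weightedTest {n : ℕ} {ρ₀ γ : ℝ} {ν : Measure ℝ}
    {p : ℝ → ℝ} {ω : Fin n → ℝ} (hp : IsTailPValue n ρ₀ ν p) (hρ₀ : 0 ≤ ρ₀)
    (hν : RegularlyVarying ν γ) (hω : ∀ i, 0 ≤ ω i) (hω0 : ∃ i, 0 < ω i)
    (hωγ : γ = 0 → ∀ i, 0 < ω i) : AsymptoticallyExact ρ₀ (weightedTest ν γ ω p) := by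
  obtain ⟨i₀, hi₀⟩ := hω0
  have hsum : 0 < ∑ i, ω i :=
    Finset.sum_pos' (fun i _ => hω i) ⟨i₀, Finset.mem_univ _, hi₀⟩
  have hκ : 0 < ∑ i, ω i ^ γ :=
    Finset.sum_pos' (fun i _ => Real.rpow_nonneg (hω i) γ)
      ⟨i₀, Finset.mem_univ _, Real.rpow_pos_of_pos hi₀ γ⟩
  refine asymptoticallyExact_of_eventually hρ₀ fun ε hε => ?_
  set κ := ∑ i, ω i ^ γ with hκ_def
  have hdiv : Tendsto (fun α : ℝ => α / κ) (𝓝[>] 0) (𝓝[>] 0) := by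
    refine tendsto_nhdsWithin_iff.2 ⟨?_, ?_⟩
    · have h : Tendsto (fun α : ℝ => α / κ) (𝓝 0) (𝓝 (0 / κ)) := tendsto_id.div_const κ
      rw [zero_div] at h
      exact h.mono_left nhdsWithin_le_nhds
    · filter_upwards [self_mem_nhdsWithin] with α hα
      exact div_pos hα hκ
  have hratio := hν.tendsto_survival_quantile.comp hdiv
  have hev := ((tendsto_quantile_atTop hν.survival_pos).comp hdiv).eventually
    (hp.eventually_abs_real_sumExceedance_sub_le hν hω hsum hωγ
      (show 0 < κ * (ε / 4) by positivity))
  -- With `r` the ratio of `survival ν q` to `α / κ`, the rejection probability is within `ε / 4 *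
  -- (r * α)` of `r * α`. Here `r < 2` turns that error into `ε / 2 * α`, and `|r - 1| < ε / 2`
  -- accounts for the other half.
  have hε' : 0 < min (ε / 2) 1 := lt_min (half_pos hε) one_pos
  filter_upwards [hev, Metric.tendsto_nhds.1 hratio _ hε', self_mem_nhdsWithin] with α h1 h2 hα P hP
  have hα : 0 < α := hα
  set q := quantile ν (1 - α / κ) with hq
  have hPR := h1 P hP
  simp only [Function.comp_apply, ← hq] at hPR h2
  rw [Real.dist_eq] at h2
  set r := survival ν q / (α / κ) with hr
  have hS : κ * survival ν q = r * α := by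
    rw [hr]; field_simp
  have h3 := abs_lt.1 (h2.trans_le (min_le_left _ _))
  have h4 := abs_lt.1 (h2.trans_le (min_le_right _ _))
  have h5 : errorRatio (weightedTest ν γ ω p) α P = P.real (sumExceedance ν p ω q) / α := rfl
  rw [mul_right_comm, hS, abs_le] at hPR
  rw [h5, abs_le, le_sub_iff_add_le, sub_le_iff_le_add, le_div_iff₀ hα, div_le_iff₀ hα]
  have h6 : r * α * (ε / 4) ≤ 2 * α * (ε / 4) := by
    gcongr
    linarith
  have h7 : -(ε / 2) * α < (r - 1) * α := by
    gcongr
    exact h3.1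
  have h8 : (r - 1) * α < ε / 2 * α := by
    gcongr
    exact h3.2
  constructor <;> linarith

end HeavyTail

open HeavyTail in
theorem mainTheorem1 (n : ℕ) (hn : 1 ≤ n) (ρ₀ : ℝ) (hρ₀ : 0 ≤ ρ₀) (hρ₁ : ρ₀ < 1)
    (ν : Measure ℝ) [IsProbabilityMeasure ν] (γ : ℝ) (hν : RegularlyVarying ν γ)
    (p : ℝ → ℝ)
    (hp : p = twoSidedPValue ∨
      (p = oneSidedPValue ∧ ∀ᶠ x : ℝ in atTop, cdf ν (-x) ≤ survival ν x)) :
    AsymptoticallyExact ρ₀ (sumTest n ν p) ∧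
    (γ = 1 → AsymptoticallyExact ρ₀ (averageTest n ν p)) ∧
    (∀ ω : Fin n → ℝ, (∀ i, 0 ≤ ω i) → (∃ i, 0 < ω i) → (γ = 0 → ∀ i, 0 < ω i) →
      AsymptoticallyExact ρ₀ (weightedTest ν γ ω p)) := by
  have htail : IsTailPValue n ρ₀ ν p := by
    rcases hp with rfl | ⟨rfl, h⟩
    · exact isTailPValue_twoSided hρ₀ hρ₁ hν.survival_pos
    · exact isTailPValue_oneSided hρ₀ hρ₁ hν.survival_pos h
  have hn0 : (0 : ℝ) < n := by exact_mod_cast hn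
  refine ⟨?_, fun hγ => ?_, fun ω hω hω0 hωγ =>
    htail.asymptoticallyExact_weightedTest hρ₀ hν hω hω0 hωγ⟩
  -- Unit weights give `κ = n`.
  · have h := htail.asymptoticallyExact_weightedTest (ω := fun _ => 1) hρ₀ hν
      (fun _ => zero_le_one) ⟨⟨0, hn⟩, one_pos⟩ (fun _ _ => one_pos)
    convert h using 1
    ext α T
    simp [sumTest, weightedTest]
  · subst hγ
    -- Weights `1 / n` give `κ = n * (1 / n) = 1`, precisely because `γ = 1`.
    have h := htail.asymptoticallyExact_weightedTest (ω := fun _ => (n : ℝ)⁻¹) hρ₀ hν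
      (fun _ => by positivity) ⟨⟨0, hn⟩, by positivity⟩ (fun _ _ => by positivity)
    convert h using 1
    ext α T
    simp [averageTest, weightedTest, ← Finset.mul_sum, hn0.ne', div_eq_inv_mul]
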